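/- Let $(\alpha_k)_{k\ge 0}$ be a sequence of complex numbers with $|\alpha_k|<1$ for all $k$, not all of them zero, and put $\rho_k=\sqrt{1-|\alpha_k|^2}$ and $\Theta_k=\begin{pmatrix}\overline{\alpha_k}&\rho_k\\ \rho_k&-\alpha_k\end{pmatrix}$. Let $\mathcal L=\Theta_0\oplus\Theta_2\oplus\Theta_4\oplus\cdots$ and $\mathcal M=1\oplus\Theta_1\oplus\Theta_3\oplus\cdots$ be the associated block diagonal infinite matrices (rows and columns indexed by $0,1,2,\dots$), and let $\mathcal C=\mathcal L\mathcal M$ be the CMV matrix with Verblunsky coefficients $(\alpha_k)$. For an infinite complex band matrix $\Omega$ put $(\operatorname{ad}\mathcal C)\Omega=\mathcal C\Omega-\Omega\,\mathcal C$, and for an integer $n\ge 0$ define $$(\operatorname{ad}_n\mathcal C)\Omega=\begin{cases}(\mathcal C^\dagger)^m\,\big((\operatorname{ad}\mathcal C)^n\Omega\big)\,(\mathcal C^\dagger)^m, & n=2m,\\ \mathcal L^\dagger(\mathcal C^\dagger)^m\,\big((\operatorname{ad}\mathcal C)^n\Omega\big)\,(\mathcal C^\dagger)^m\mathcal M^\dagger,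 & n=2m+1,\end{cases}$$ where $\dagger$ denotes the conjugate transpose. Call $\Omega$ almost tridiagonal if $\Omega-\widetilde\Omega$ has only finitely many non-zero entries for some tridiagonal infinite matrix $\widetilde\Omega$. If $\Omega$ is almost tridiagonal and $(\operatorname{ad}_n\mathcal C)\Omega=0$ for some integer $n\ge 0$, then $\Omega=cI$ for some $c\in\mathbb C$, where $I$ is the infinite identity matrix. -/

import Mathlib

open scoped Matrix ComplexConjugate

noncomputable section

namespace CMV

/-- Infinite complex matrices with rows and columns indexed by `0, 1, 2, …`. -/
abbrev InfMatrix := Matrix ℕ ℕ ℂ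

/-- The usual row-by-column product of infinite matrices. The sum is finite whenever one of the
two factors is a band matrix, which is the case in every product used below. -/
def mul (A B : InfMatrix) : InfMatrix :=
  Matrix.of fun i j => ∑ᶠ k, A i k * B k j

/-- Powers for the product `mul`. -/
def pow (A : InfMatrix) : ℕ → InfMatrix
  | 0 => 1
  | m + 1 => mul A (pow A m)

/-- `ρ_n = √(1 - |α_n|²)`. -/
def rho (α : ℕ → ℂ) (n : ℕ) : ℝ := √(1 - ‖α n‖ ^ 2)

/-- The matrix `L = Θ₀ ⊕ Θ₂ ⊕ Θ₄ ⊕ ⋯`, where `Θ_n = [[conj α_n, ρ_n], [ρ_n, -α_n]]`; for even `n`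
the block `Θ_n` occupies the rows and columns `n, n + 1`. -/
def matL (α : ℕ → ℂ) : InfMatrix := Matrix.of fun i j =>
  if i = j then (if Even i then conj (α i) else -α (i - 1))
  else if j = i + 1 ∧ Even i then (rho α i : ℂ)
  else if i = j + 1 ∧ Even j then (rho α j : ℂ)
  else 0

/-- The matrix `M = 1 ⊕ Θ₁ ⊕ Θ₃ ⊕ ⋯`; for odd `n` the block `Θ_n` occupies the rows and columns
`n, n + 1`. -/
def matM (α : ℕ → ℂ) : InfMatrix := Matrix.of fun i j =>
  if i = j then (if i = 0 then 1 else if Odd i then conj (α i) else -α (i - 1))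
  else if j = i + 1 ∧ Odd i then (rho α i : ℂ)
  else if i = j + 1 ∧ Odd j then (rho α j : ℂ)
  else 0

/-- The CMV matrix `C = L M` with Verblunsky coefficients `α`. -/
def matC (α : ℕ → ℂ) : InfMatrix := mul (matL α) (matM α)

/-- The commutator operator `(ad A) Ω = A Ω - Ω A`. -/
def ad (A Ω : InfMatrix) : InfMatrix := mul A Ω - mul Ω A

/-- The Hermitian ad-operator `(ad_n C) Ω` of the CMV matrix `C = L M`:
`(C†)^m ((ad C)^n Ω) (C†)^m` for `n = 2 m`, and
`L† (C†)^m ((ad C)^n Ω) (C†)^m M†` for `n = 2 m + 1`. -/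
def hermAd (α : ℕ → ℂ) (n : ℕ) (Ω : InfMatrix) : InfMatrix :=
  let P : InfMatrix := pow (matC α)ᴴ (n / 2)
  let X : InfMatrix := mul (mul P ((ad (matC α))^[n] Ω)) P
  if Even n then X else mul (mul (matL α)ᴴ X) (matM α)ᴴ

/-- Tridiagonal matrices. -/
def IsTridiagonal (T : InfMatrix) : Prop :=
  ∀ i j : ℕ, i + 1 < j ∨ j + 1 < i → T i j = 0

/-- Almost tridiagonal matrices: those that differ from a tridiagonal matrix in at most finitely
many entries. -/
def IsAlmostTridiagonal (Ω : InfMatrix) : Prop :=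
  ∃ T : InfMatrix, IsTridiagonal T ∧ {p : ℕ × ℕ | (Ω - T) p.1 p.2 ≠ 0}.Finite

end CMV

end

open scoped Matrix ComplexConjugate

namespace CMV

/-! Column-finite matrices act on finitely supported vectors, where $\mathcal L,\mathcal M,\mathcal
C$ are invertible with inverse $\dagger$; the outer factors of $\operatorname{ad}_n$ cancel and the
hypothesis becomes $(\operatorname{ad}\mathcal C)^n\Omega=0$. The vectors $\mathcal C^s e_0$,
$s\in\mathbb Z$, form a basis (`orbitBasis`), triangular against the standard one in the order
$0,1,-1,2,-2,\dots$, and $\mathcal C$ shifts it by one. There $\operatorname{ad}\mathcal C$ takes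
differences along diagonals, so every diagonal of $\Omega$ is polynomial in $s$. Almost
tridiagonality kills each diagonal $l\ne0$ near one end of $\mathbb Z$, hence everywhere
(`repr_diagonal_eq_zero`). So $\Omega$ is diagonal in the orbit basis and upper triangular in the
standard one. The same holds for $\Omega^\dagger$, so $\Omega$ is diagonal in the standard basis
too. Induction on $n$ then makes $\mathcal C^\dagger\Omega\,\mathcal C-\Omega$ a scalar $c$
(`eq_smul_one_of_orbit`). The $\rho$-entries of $\mathcal C$ make the diagonal of $\Omega$
arithmetic with step governed by $c$, and a nonzero $\alpha_k$ contradicts this unless $c=0$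
(`eq_smul_one_of_diagonal`). -/

/-! ### Column-finite matrices as operators on finitely supported vectors -/

/-- Every column has only finitely many non-zero entries. -/
def ColFinite (A : InfMatrix) : Prop := ∀ j, (Function.support fun i => A i j).Finite

open Classical in
/-- The operator on finitely supported vectors given by a column-finite matrix. -/
noncomputable def toEnd (A : InfMatrix) : Module.End ℂ (ℕ →₀ ℂ) :=
  Finsupp.linearCombination ℂ fun j =>
    if h : (Function.support fun i => A i j).Finite then
      Finsupp.ofSupportFinite (fun i => A i j) h else 0

theorem toEnd_single {A : InfMatrix} (hA : ColFinite A) (i j : ℕ) :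
    toEnd A (Finsupp.single j 1) i = A i j := by
  simp [toEnd, dif_pos (hA j), Finsupp.ofSupportFinite_coe]

theorem toEnd_apply {A : InfMatrix} (hA : ColFinite A) (w : ℕ →₀ ℂ) (i : ℕ) :
    toEnd A w i = ∑ k ∈ w.support, w k * A i k := by
  have h : ∀ j, (Function.support fun i => A i j).Finite := hA
  simp [toEnd, h, Finsupp.linearCombination_apply, Finsupp.sum, Finsupp.ofSupportFinite_coe]

theorem end_ext {X Y : Module.End ℂ (ℕ →₀ ℂ)}
    (h : ∀ i j, X (Finsupp.single j 1) i = Y (Finsupp.single j 1) i) : X = Y := by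
  refine Finsupp.lhom_ext' fun j => LinearMap.ext_ring ?_
  ext i
  exact h i j

theorem toEnd_injective {A B : InfMatrix} (hA : ColFinite A) (hB : ColFinite B)
    (h : toEnd A = toEnd B) : A = B := by
  ext i j
  rw [← toEnd_single hA, ← toEnd_single hB, h]

theorem mul_apply_eq_sum {A B : InfMatrix} (hB : ColFinite B) (i j : ℕ) :
    mul A B i j = ∑ k ∈ (hB j).toFinset, A i k * B k j := by
  refine finsum_eq_sum_of_support_subset _ fun k hk => ?_
  simpa using right_ne_zero_of_mul hk

theorem ColFinite.mul {A B : InfMatrix} (hA : ColFinite A) (hB : ColFinite B) :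
    ColFinite (mul A B) := by
  intro j
  refine ((hB j).biUnion fun k _ => hA k).subset fun i hi => ?_
  rw [Function.mem_support, mul_apply_eq_sum hB] at hi
  obtain ⟨k, -, hk⟩ := Finset.exists_ne_zero_of_sum_ne_zero hi
  exact Set.mem_biUnion (x := k) (right_ne_zero_of_mul hk) (left_ne_zero_of_mul hk)

theorem ColFinite.sub {A B : InfMatrix} (hA : ColFinite A) (hB : ColFinite B) :
    ColFinite (A - B) := fun j =>
  ((hA j).union (hB j)).subset (Function.support_sub _ _)

theorem colFinite_one : ColFinite 1 := fun j =>
  (Set.finite_singleton j).subset fun i hi => by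
    by_contra h
    exact hi (Matrix.one_apply_ne h)

theorem colFinite_zero : ColFinite 0 := fun j => by
  simp [Function.support]

theorem colFinite_pow {A : InfMatrix} (hA : ColFinite A) (m : ℕ) : ColFinite (pow A m) := by
  induction m with
  | zero => exact colFinite_one
  | succ m ih => exact hA.mul ih

theorem ColFinite.ad {A B : InfMatrix} (hA : ColFinite A) (hB : ColFinite B) :
    ColFinite (ad A B) := (hA.mul hB).sub (hB.mul hA)

theorem ColFinite.ad_iterate {A B : InfMatrix} (hA : ColFinite A) (hB : ColFinite B) (n : ℕ) :
    ColFinite ((CMV.ad A)^[n] B) := by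
  induction n with
  | zero => exact hB
  | succ n ih => rw [Function.iterate_succ_apply']; exact hA.ad ih

theorem toEnd_mul {A B : InfMatrix} (hA : ColFinite A) (hB : ColFinite B) :
    toEnd (mul A B) = toEnd A * toEnd B := by
  refine end_ext fun i j => ?_
  rw [toEnd_single (hA.mul hB), Module.End.mul_apply, toEnd_apply hA, mul_apply_eq_sum hB]
  refine Finset.sum_congr ?_ fun k _ => ?_
  · ext k
    simp [toEnd_single hB]
  · rw [toEnd_single hB, mul_comm]

theorem toEnd_sub {A B : InfMatrix} (hA : ColFinite A) (hB : ColFinite B) :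
    toEnd (A - B) = toEnd A - toEnd B := by
  refine end_ext fun i j => ?_
  simp [toEnd_single, hA, hB, hA.sub hB]

theorem toEnd_one : toEnd 1 = 1 := by
  refine end_ext fun i j => ?_
  rw [toEnd_single colFinite_one]
  simp [Matrix.one_apply, Finsupp.single_apply, eq_comm]

theorem toEnd_zero : toEnd 0 = 0 := by
  refine end_ext fun i j => ?_
  rw [toEnd_single colFinite_zero]
  simp

theorem toEnd_pow {A : InfMatrix} (hA : ColFinite A) (m : ℕ) :
    toEnd (pow A m) = toEnd A ^ m := by
  induction m with
  | zero => exact toEnd_one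
  | succ m ih => rw [pow, toEnd_mul hA (colFinite_pow hA m), ih, pow_succ']

/-- The commutator operator in a ring. -/
def comm {R : Type*} [Ring R] (a x : R) : R := a * x - x * a

theorem toEnd_ad_iterate {A B : InfMatrix} (hA : ColFinite A) (hB : ColFinite B) (n : ℕ) :
    toEnd ((ad A)^[n] B) = (comm (toEnd A))^[n] (toEnd B) := by
  induction n with
  | zero => rfl
  | succ n ih =>
    have h := hA.ad_iterate hB n
    rw [Function.iterate_succ_apply', Function.iterate_succ_apply', ← ih, ad,
      toEnd_sub (hA.mul h) (h.mul hA), toEnd_mul hA h, toEnd_mul h hA, comm]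

/-- No finiteness is needed: conjugation is an additive equivalence, so it commutes with `finsum`
even when that takes its default value. -/
theorem conjTranspose_mul (A B : InfMatrix) : (mul A B)ᴴ = mul Bᴴ Aᴴ := by
  ext i j
  change star (∑ᶠ k, A j k * B k i) = ∑ᶠ k, star (B k i) * star (A j k)
  change starAddEquiv (∑ᶠ k, A j k * B k i) = _
  rw [AddEquiv.map_finsum]
  simp [mul_comm]

/-! ### Iterated commutators with a unit -/

section Commutator

variable {R : Type*} [Ring R]

theorem comm_iterate_mul_left {a b : R} (h : a * b = b * a) (n : ℕ) (x : R) :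
    (comm a)^[n] (b * x) = b * (comm a)^[n] x := by
  induction n with
  | zero => rfl
  | succ n ih =>
    rw [Function.iterate_succ_apply', Function.iterate_succ_apply', ih, comm, comm, mul_sub,
      ← mul_assoc, h, mul_assoc, mul_assoc]

theorem comm_iterate_mul_right {a b : R} (h : a * b = b * a) (n : ℕ) (x : R) :
    (comm a)^[n] (x * b) = (comm a)^[n] x * b := by
  induction n with
  | zero => rfl
  | succ n ih =>
    rw [Function.iterate_succ_apply', Function.iterate_succ_apply', ih, comm, comm, sub_mul,
      mul_assoc, mul_assoc, ← h, mul_assoc]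

theorem comm_iterate_neg (a : R) (n : ℕ) (x : R) :
    (comm a)^[n] (-x) = -(comm a)^[n] x := by
  induction n with
  | zero => rfl
  | succ n ih =>
    rw [Function.iterate_succ_apply', Function.iterate_succ_apply', ih, comm, comm]
    noncomm_ring

/-- Rests on $[u^{-1},x]=-u^{-1}[u,x]u^{-1}$, whose outer factors commute with $u$ and so pass
through further commutators. It is what transfers the hypothesis from $\Omega$ to $\Omega^\dagger$.
-/
theorem comm_iterate_eq_zero_of_inv (u : Rˣ) (n : ℕ) (x : R)
    (h : (comm (↑u⁻¹ : R))^[n] x = 0) : (comm (u : R))^[n] x = 0 := by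
  induction n generalizing x with
  | zero => exact h
  | succ n ih =>
    have h1 := ih _ (by rwa [Function.iterate_succ_apply] at h)
    have h2 : comm (↑u⁻¹ : R) x = -(↑u⁻¹ * (comm (u : R) x * ↑u⁻¹)) := by
      simp [comm, mul_sub, sub_mul, mul_assoc]
    rw [h2, comm_iterate_neg, comm_iterate_mul_left (by simp), comm_iterate_mul_right (by simp),
      neg_eq_zero] at h1
    rw [Function.iterate_succ_apply]
    simpa using h1

/-- Conjugation turns one commutator into a difference. -/
theorem comm_iterate_conj_sub (u : Rˣ) (n : ℕ) (x : R) (h : (comm (u : R))^[n + 1] x = 0) :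
    (comm (u : R))^[n] (↑u⁻¹ * (x * u) - x) = 0 := by
  have h2 : ↑u⁻¹ * (x * u) - x = -(↑u⁻¹ * comm (u : R) x) := by
    simp [comm, mul_sub]
  rw [h2, comm_iterate_neg, comm_iterate_mul_left (by simp), ← Function.iterate_succ_apply, h]
  simp

end Commutator

/-! ### Unitarity of $\mathcal L$, $\mathcal M$ and $\mathcal C$ -/

theorem rho_pos {α : ℕ → ℂ} (hα : ∀ k, ‖α k‖ < 1) (k : ℕ) : 0 < rho α k :=
  Real.sqrt_pos.2 (by nlinarith [hα k, norm_nonneg (α k)])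

theorem rho_ne_zero {α : ℕ → ℂ} (hα : ∀ k, ‖α k‖ < 1) (k : ℕ) : (rho α k : ℂ) ≠ 0 :=
  Complex.ofReal_ne_zero.2 (rho_pos hα k).ne'

theorem mul_conj_add_rho_sq {α : ℕ → ℂ} (hα : ∀ k, ‖α k‖ < 1) (k : ℕ) :
    α k * conj (α k) + (rho α k : ℂ) * rho α k = 1 := by
  rw [Complex.mul_conj', ← Complex.ofReal_mul, rho,
    Real.mul_self_sqrt (by nlinarith [hα k, norm_nonneg (α k)])]
  push_cast
  ring

theorem rho_conj (α : ℕ → ℂ) : rho (fun k => conj (α k)) = rho α := by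
  ext k
  simp [rho]

theorem conjTranspose_matL (α : ℕ → ℂ) : (matL α)ᴴ = matL fun k => conj (α k) := by
  ext i j
  simp only [Matrix.conjTranspose_apply, matL, Matrix.of_apply, rho_conj]
  split_ifs <;> first | (exfalso; lia) | (subst_vars; simp)

theorem conjTranspose_matM (α : ℕ → ℂ) : (matM α)ᴴ = matM fun k => conj (α k) := by
  ext i j
  simp only [Matrix.conjTranspose_apply, matM, Matrix.of_apply, rho_conj]
  split_ifs <;> first | (exfalso; lia) | (subst_vars; simp)

/-- `i / 2` numbers the $2\times2$ block containing `i`; for $\mathcal M$ the number is `(i + 1) /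
2`, since index 0 is a block of its own. -/
theorem matL_eq_zero (α : ℕ → ℂ) {i j : ℕ} (h : i / 2 ≠ j / 2) : matL α i j = 0 := by
  simp only [matL, Matrix.of_apply, Nat.even_iff]
  split_ifs <;> first | rfl | (exfalso; lia)

theorem matM_eq_zero (α : ℕ → ℂ) {i j : ℕ} (h : (i + 1) / 2 ≠ (j + 1) / 2) :
    matM α i j = 0 := by
  simp only [matM, Matrix.of_apply, Nat.odd_iff]
  split_ifs <;> first | rfl | (exfalso; lia)

theorem colFinite_matL (α : ℕ → ℂ) : ColFinite (matL α) := fun j =>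
  (Set.finite_Iic (j + 1)).subset fun i hi => by
    by_contra h
    exact hi (matL_eq_zero α (by simp at h; lia))

theorem colFinite_matM (α : ℕ → ℂ) : ColFinite (matM α) := fun j =>
  (Set.finite_Iic (j + 1)).subset fun i hi => by
    by_contra h
    exact hi (matM_eq_zero α (by simp at h; lia))

@[simp] theorem matL_even_even (α : ℕ → ℂ) (m : ℕ) :
    matL α (2 * m) (2 * m) = conj (α (2 * m)) := by simp [matL]

@[simp] theorem matL_even_odd (α : ℕ → ℂ) (m : ℕ) :
    matL α (2 * m) (2 * m + 1) = rho α (2 * m) := by simp [matL]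

@[simp] theorem matL_odd_even (α : ℕ → ℂ) (m : ℕ) :
    matL α (2 * m + 1) (2 * m) = rho α (2 * m) := by simp [matL]

@[simp] theorem matL_odd_odd (α : ℕ → ℂ) (m : ℕ) :
    matL α (2 * m + 1) (2 * m + 1) = -α (2 * m) := by simp [matL]

@[simp] theorem matM_zero (α : ℕ → ℂ) : matM α 0 0 = 1 := by simp [matM]

@[simp] theorem matM_odd_odd (α : ℕ → ℂ) (m : ℕ) :
    matM α (2 * m + 1) (2 * m + 1) = conj (α (2 * m + 1)) := by simp [matM]

@[simp] theorem matM_odd_even (α : ℕ → ℂ) (m : ℕ) :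
    matM α (2 * m + 1) (2 * m + 2) = rho α (2 * m + 1) := by simp [matM]

@[simp] theorem matM_even_odd (α : ℕ → ℂ) (m : ℕ) :
    matM α (2 * m + 2) (2 * m + 1) = rho α (2 * m + 1) := by simp [matM]

@[simp] theorem matM_even_even (α : ℕ → ℂ) (m : ℕ) :
    matM α (2 * m + 2) (2 * m + 2) = -α (2 * m + 1) := by
  simp [matM, Nat.odd_iff]

theorem mul_apply_of_two {A B : InfMatrix} {i p q : ℕ} (hpq : p ≠ q)
    (h : ∀ k, k ≠ p → k ≠ q → A i k = 0) (j : ℕ) :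
    mul A B i j = A i p * B p j + A i q * B q j := by
  change ∑ᶠ k, A i k * B k j = _
  rw [finsum_eq_sum_of_support_subset (s := {p, q}), Finset.sum_pair hpq]
  intro k hk
  by_contra hc
  simp only [Finset.coe_insert, Finset.coe_singleton, Set.mem_insert_iff,
    Set.mem_singleton_iff, not_or] at hc
  exact hk (by simp [h k hc.1 hc.2])

theorem matL_mul_even (α : ℕ → ℂ) (B : InfMatrix) (m j : ℕ) :
    mul (matL α) B (2 * m) j
      = conj (α (2 * m)) * B (2 * m) j + rho α (2 * m) * B (2 * m + 1) j := by
  rw [mul_apply_of_two (p := 2 * m) (q := 2 * m + 1) (by lia)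
    (fun k _ _ => matL_eq_zero α (by lia)), matL_even_even, matL_even_odd]

theorem matL_mul_odd (α : ℕ → ℂ) (B : InfMatrix) (m j : ℕ) :
    mul (matL α) B (2 * m + 1) j
      = rho α (2 * m) * B (2 * m) j - α (2 * m) * B (2 * m + 1) j := by
  rw [mul_apply_of_two (p := 2 * m) (q := 2 * m + 1) (by lia)
    (fun k _ _ => matL_eq_zero α (by lia)), matL_odd_even, matL_odd_odd]
  ring

theorem matM_mul_zero (α : ℕ → ℂ) (B : InfMatrix) (j : ℕ) : mul (matM α) B 0 j = B 0 j := by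
  rw [mul_apply_of_two (p := 0) (q := 1) (by lia)
    (fun k _ _ => matM_eq_zero α (by lia)), matM_zero, matM_eq_zero α (by lia)]
  ring

theorem matM_mul_odd (α : ℕ → ℂ) (B : InfMatrix) (m j : ℕ) :
    mul (matM α) B (2 * m + 1) j
      = conj (α (2 * m + 1)) * B (2 * m + 1) j + rho α (2 * m + 1) * B (2 * m + 2) j := by
  rw [mul_apply_of_two (p := 2 * m + 1) (q := 2 * m + 2) (by lia)
    (fun k _ _ => matM_eq_zero α (by lia)), matM_odd_odd, matM_odd_even]

theorem matM_mul_even (α : ℕ → ℂ) (B : InfMatrix) (m j : ℕ) :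
    mul (matM α) B (2 * m + 2) j
      = rho α (2 * m + 1) * B (2 * m + 1) j - α (2 * m + 1) * B (2 * m + 2) j := by
  rw [mul_apply_of_two (p := 2 * m + 1) (q := 2 * m + 2) (by lia)
    (fun k _ _ => matM_eq_zero α (by lia)), matM_even_odd, matM_even_even]
  ring

theorem matL_mul_conjTranspose {α : ℕ → ℂ} (hα : ∀ k, ‖α k‖ < 1) :
    mul (matL α) (matL α)ᴴ = 1 := by
  rw [conjTranspose_matL]
  have key (m : ℕ) := mul_conj_add_rho_sq hα (2 * m)
  ext i j
  rcases Nat.even_or_odd' i with ⟨m, rfl | rfl⟩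
  · rw [matL_mul_even]
    by_cases h : j / 2 = m
    · obtain rfl | rfl : j = 2 * m ∨ j = 2 * m + 1 := by lia
      · simp [rho_conj]; linear_combination key m
      · simp [rho_conj]; ring
    · rw [matL_eq_zero _ (by lia), matL_eq_zero _ (by lia), Matrix.one_apply_ne (by lia)]
      ring
  · rw [matL_mul_odd]
    by_cases h : j / 2 = m
    · obtain rfl | rfl : j = 2 * m ∨ j = 2 * m + 1 := by lia
      · simp [rho_conj]; ring
      · simp [rho_conj]; linear_combination key m
    · rw [matL_eq_zero _ (by lia), matL_eq_zero _ (by lia), Matrix.one_apply_ne (by lia)]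
      ring

theorem matM_mul_conjTranspose {α : ℕ → ℂ} (hα : ∀ k, ‖α k‖ < 1) :
    mul (matM α) (matM α)ᴴ = 1 := by
  rw [conjTranspose_matM]
  have key (m : ℕ) := mul_conj_add_rho_sq hα (2 * m + 1)
  ext i j
  obtain rfl | ⟨m, rfl | rfl⟩ : i = 0 ∨ ∃ m, i = 2 * m + 1 ∨ i = 2 * m + 2 := by
    rcases Nat.even_or_odd' i with ⟨m, rfl | rfl⟩
    · rcases m with _ | m
      · exact .inl rfl
      · exact .inr ⟨m, .inr (by ring)⟩
    · exact .inr ⟨m, .inl rfl⟩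
  · rw [matM_mul_zero]
    by_cases h : j = 0
    · subst h; simp
    · rw [matM_eq_zero _ (by lia), Matrix.one_apply_ne (by lia)]
  · rw [matM_mul_odd]
    by_cases h : (j + 1) / 2 = m + 1
    · obtain rfl | rfl : j = 2 * m + 1 ∨ j = 2 * m + 2 := by lia
      · simp [rho_conj]; linear_combination key m
      · simp [rho_conj]; ring
    · rw [matM_eq_zero _ (by lia), matM_eq_zero _ (by lia), Matrix.one_apply_ne (by lia)]
      ring
  · rw [matM_mul_even]
    by_cases h : (j + 1) / 2 = m + 1
    · obtain rfl | rfl : j = 2 * m + 1 ∨ j = 2 * m + 2 := by lia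
      · simp [rho_conj]; ring
      · simp [rho_conj]; linear_combination key m
    · rw [matM_eq_zero _ (by lia), matM_eq_zero _ (by lia), Matrix.one_apply_ne (by lia)]
      ring

theorem conjTranspose_mul_matL {α : ℕ → ℂ} (hα : ∀ k, ‖α k‖ < 1) :
    mul (matL α)ᴴ (matL α) = 1 := by
  have h := matL_mul_conjTranspose (α := fun k => conj (α k)) (by simpa using hα)
  rwa [← conjTranspose_matL, Matrix.conjTranspose_conjTranspose] at h

theorem conjTranspose_mul_matM {α : ℕ → ℂ} (hα : ∀ k, ‖α k‖ < 1) :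
    mul (matM α)ᴴ (matM α) = 1 := by
  have h := matM_mul_conjTranspose (α := fun k => conj (α k)) (by simpa using hα)
  rwa [← conjTranspose_matM, Matrix.conjTranspose_conjTranspose] at h

theorem colFinite_matL_conjTranspose (α : ℕ → ℂ) : ColFinite (matL α)ᴴ := by
  rw [conjTranspose_matL]; exact colFinite_matL _

theorem colFinite_matM_conjTranspose (α : ℕ → ℂ) : ColFinite (matM α)ᴴ := by
  rw [conjTranspose_matM]; exact colFinite_matM _

theorem colFinite_matC (α : ℕ → ℂ) : ColFinite (matC α) :=
  (colFinite_matL α).mul (colFinite_matM α)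

theorem colFinite_matC_conjTranspose (α : ℕ → ℂ) : ColFinite (matC α)ᴴ := by
  rw [matC, conjTranspose_mul]
  exact (colFinite_matM_conjTranspose α).mul (colFinite_matL_conjTranspose α)

/-- The operator of `matL α` as a unit. -/
noncomputable def unitL {α : ℕ → ℂ} (hα : ∀ k, ‖α k‖ < 1) : (Module.End ℂ (ℕ →₀ ℂ))ˣ where
  val := toEnd (matL α)
  inv := toEnd (matL α)ᴴ
  val_inv := by
    rw [← toEnd_mul (colFinite_matL α) (colFinite_matL_conjTranspose α),
      matL_mul_conjTranspose hα, toEnd_one]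
  inv_val := by
    rw [← toEnd_mul (colFinite_matL_conjTranspose α) (colFinite_matL α),
      conjTranspose_mul_matL hα, toEnd_one]

/-- The operator of `matM α` as a unit. -/
noncomputable def unitM {α : ℕ → ℂ} (hα : ∀ k, ‖α k‖ < 1) : (Module.End ℂ (ℕ →₀ ℂ))ˣ where
  val := toEnd (matM α)
  inv := toEnd (matM α)ᴴ
  val_inv := by
    rw [← toEnd_mul (colFinite_matM α) (colFinite_matM_conjTranspose α),
      matM_mul_conjTranspose hα, toEnd_one]
  inv_val := by
    rw [← toEnd_mul (colFinite_matM_conjTranspose α) (colFinite_matM α),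
      conjTranspose_mul_matM hα, toEnd_one]

/-- The operator of the CMV matrix as a unit. -/
noncomputable def unitC {α : ℕ → ℂ} (hα : ∀ k, ‖α k‖ < 1) : (Module.End ℂ (ℕ →₀ ℂ))ˣ :=
  unitL hα * unitM hα

theorem val_unitC {α : ℕ → ℂ} (hα : ∀ k, ‖α k‖ < 1) :
    (unitC hα : Module.End ℂ (ℕ →₀ ℂ)) = toEnd (matC α) :=
  (toEnd_mul (colFinite_matL α) (colFinite_matM α)).symm

theorem inv_unitC {α : ℕ → ℂ} (hα : ∀ k, ‖α k‖ < 1) :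
    (↑(unitC hα)⁻¹ : Module.End ℂ (ℕ →₀ ℂ)) = toEnd (matC α)ᴴ := by
  rw [matC, conjTranspose_mul, toEnd_mul (colFinite_matM_conjTranspose α)
    (colFinite_matL_conjTranspose α), unitC, mul_inv_rev]
  rfl

/-! ### Entries of the CMV matrix -/

theorem matC_even (α : ℕ → ℂ) (m j : ℕ) :
    matC α (2 * m) j
      = conj (α (2 * m)) * matM α (2 * m) j + rho α (2 * m) * matM α (2 * m + 1) j :=
  matL_mul_even α _ m j

theorem matC_odd (α : ℕ → ℂ) (m j : ℕ) :
    matC α (2 * m + 1) j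
      = rho α (2 * m) * matM α (2 * m) j - α (2 * m) * matM α (2 * m + 1) j :=
  matL_mul_odd α _ m j

theorem matC_eq_zero (α : ℕ → ℂ) {i j : ℕ} (h : i + 2 < j ∨ j + 2 < i) : matC α i j = 0 := by
  rcases Nat.even_or_odd' i with ⟨m, rfl | rfl⟩
  · rw [matC_even, matM_eq_zero _ (by lia), matM_eq_zero _ (by lia)]; ring
  · rw [matC_odd, matM_eq_zero _ (by lia), matM_eq_zero _ (by lia)]; ring

theorem matC_two_zero (α : ℕ → ℂ) : matC α 2 0 = 0 := by
  have h := matC_even α 1 0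
  rw [matM_eq_zero _ (by lia), matM_eq_zero _ (by lia)] at h
  simpa using h

theorem matC_zero_zero (α : ℕ → ℂ) : matC α 0 0 = conj (α 0) := by
  have h := matC_even α 0 0
  rw [matM_zero, matM_eq_zero _ (by lia)] at h
  simpa using h

theorem matC_one_zero (α : ℕ → ℂ) : matC α 1 0 = rho α 0 := by
  have h := matC_odd α 0 0
  rw [matM_zero, matM_eq_zero _ (by lia)] at h
  simpa using h

theorem matC_even_add_two (α : ℕ → ℂ) (m : ℕ) :
    matC α (2 * m) (2 * m + 2) = rho α (2 * m) * rho α (2 * m + 1) := by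
  rw [matC_even, matM_eq_zero _ (by lia), matM_odd_even]; ring

theorem matC_odd_add_two (α : ℕ → ℂ) (m : ℕ) :
    matC α (2 * m + 3) (2 * m + 1) = rho α (2 * m + 2) * rho α (2 * m + 1) := by
  have h := matC_odd α (m + 1) (2 * m + 1)
  rw [matM_eq_zero (i := 2 * (m + 1) + 1) _ (by lia)] at h
  simpa [mul_add] using h

theorem matC_even_add_one (α : ℕ → ℂ) (m : ℕ) :
    matC α (2 * m) (2 * m + 1) = rho α (2 * m) * conj (α (2 * m + 1)) := by
  rw [matC_even, matM_eq_zero _ (by lia), matM_odd_odd]; ring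

theorem matC_add_one_odd (α : ℕ → ℂ) (m : ℕ) :
    matC α (2 * m + 2) (2 * m + 1) = conj (α (2 * m + 2)) * rho α (2 * m + 1) := by
  have h := matC_even α (m + 1) (2 * m + 1)
  rw [matM_eq_zero (i := 2 * (m + 1) + 1) _ (by lia)] at h
  simpa [mul_add] using h

theorem toEnd_apply_eq_zero {A : InfMatrix} (hA : ColFinite A) {w : ℕ →₀ ℂ} {i J : ℕ}
    (hw : ∀ k, J < k → w k = 0) (h : ∀ k ≤ J, A i k = 0) : toEnd A w i = 0 := by
  rw [toEnd_apply hA]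
  refine Finset.sum_eq_zero fun k hk => ?_
  rw [h k (not_lt.1 fun hJ => Finsupp.mem_support_iff.1 hk (hw k hJ)), mul_zero]

theorem toEnd_apply_eq_single {A : InfMatrix} (hA : ColFinite A) {w : ℕ →₀ ℂ} {i J : ℕ}
    (hw : ∀ k, J < k → w k = 0) (h : ∀ k < J, A i k = 0) : toEnd A w i = w J * A i J := by
  rw [toEnd_apply hA]
  refine Finset.sum_eq_single J (fun k _ hkJ => ?_) fun hJ => ?_
  · rcases hkJ.lt_or_gt with hlt | hgt
    · rw [h k hlt, mul_zero]
    · rw [hw k hgt, zero_mul]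
  · rw [Finsupp.notMem_support_iff.1 hJ, zero_mul]

/-! ### The orbit of $e_0$ as a basis -/

/-- The position of the exponent `s` in the list `0, 1, -1, 2, -2, …`. -/
def level (s : ℤ) : ℕ := if 0 < s then (2 * s - 1).toNat else (-2 * s).toNat

theorem level_injective : Function.Injective level := fun s t h => by
  unfold level at h
  split_ifs at h <;> lia

theorem level_surjective : Function.Surjective level := fun j => by
  rcases Nat.even_or_odd' j with ⟨m, rfl | rfl⟩
  · refine ⟨-m, ?_⟩
    unfold level
    split_ifs <;> lia
  · refine ⟨m + 1, ?_⟩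
    unfold level
    split_ifs <;> lia

variable {α : ℕ → ℂ} (hα : ∀ k, ‖α k‖ < 1)

/-- The orbit `C ^ s e₀`, corresponding to the monomial `z ^ s`. -/
noncomputable def orbit (s : ℤ) : ℕ →₀ ℂ :=
  (↑(unitC hα ^ s) : Module.End ℂ (ℕ →₀ ℂ)) (Finsupp.single 0 1)

theorem unitC_orbit (s : ℤ) :
    (unitC hα : Module.End ℂ (ℕ →₀ ℂ)) (orbit hα s) = orbit hα (s + 1) := by
  rw [orbit, orbit, add_comm, zpow_one_add, Units.val_mul, Module.End.mul_apply]

theorem unitC_inv_orbit (s : ℤ) :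
    (↑(unitC hα)⁻¹ : Module.End ℂ (ℕ →₀ ℂ)) (orbit hα (s + 1)) = orbit hα s := by
  rw [← unitC_orbit, ← Module.End.mul_apply, Units.inv_mul, Module.End.one_apply]

/-- Each application of $\mathcal C$ moves the last nonzero coordinate from $2m+1$ to $2m+3$,
because the band entry of `matC_odd_add_two` is a product of two $\rho$'s. For negative powers,
$\mathcal C^\dagger$ and `matC_even_add_two` do the same on even positions. -/
theorem orbit_pos (m : ℕ) :
    (∀ k, 2 * m + 1 < k → orbit hα (m + 1) k = 0) ∧ orbit hα (m + 1) (2 * m + 1) ≠ 0 := by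
  induction m with
  | zero =>
    have h : orbit hα ((0 : ℕ) + 1) = toEnd (matC α) (Finsupp.single 0 1) := by
      rw [← val_unitC hα, orbit]
      simp
    rw [h]
    refine ⟨fun k hk => ?_, ?_⟩
    · rw [toEnd_single (colFinite_matC α)]
      obtain rfl | hk : k = 2 ∨ 2 < k := by lia
      · exact matC_two_zero α
      · exact matC_eq_zero α (by lia)
    · rw [toEnd_single (colFinite_matC α), matC_one_zero]
      exact rho_ne_zero hα 0
  | succ m ih =>
    push_cast
    rw [← unitC_orbit, val_unitC]
    refine ⟨fun k hk => ?_, ?_⟩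
    · exact toEnd_apply_eq_zero (colFinite_matC α) ih.1 fun j hj => matC_eq_zero α (by lia)
    · rw [toEnd_apply_eq_single (colFinite_matC α) ih.1 fun j hj => matC_eq_zero α (by lia)]
      exact mul_ne_zero ih.2 ((matC_odd_add_two α m).trans_ne
        (mul_ne_zero (rho_ne_zero hα _) (rho_ne_zero hα _)))

theorem orbit_neg (m : ℕ) :
    (∀ k, 2 * m < k → orbit hα (-m) k = 0) ∧ orbit hα (-m) (2 * m) ≠ 0 := by
  induction m with
  | zero =>
    have h : orbit hα (-(0 : ℕ)) = Finsupp.single 0 1 := by simp [orbit]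
    rw [h]
    refine ⟨fun k hk => Finsupp.single_eq_of_ne (by lia), by simp⟩
  | succ m ih =>
    have h : orbit hα (-(m + 1 : ℕ)) = toEnd (matC α)ᴴ (orbit hα (-m)) := by
      rw [← unitC_inv_orbit hα, inv_unitC]
      congr 2
      push_cast
      ring
    rw [h]
    refine ⟨fun k hk => ?_, ?_⟩
    · refine toEnd_apply_eq_zero (colFinite_matC_conjTranspose α) ih.1 fun j hj => ?_
      rw [Matrix.conjTranspose_apply, matC_eq_zero α (by lia), star_zero]
    · rw [toEnd_apply_eq_single (colFinite_matC_conjTranspose α) ih.1 fun j hj => by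
        rw [Matrix.conjTranspose_apply, matC_eq_zero α (by lia), star_zero]]
      exact mul_ne_zero ih.2 (star_ne_zero.2 ((matC_even_add_two α m).trans_ne
        (mul_ne_zero (rho_ne_zero hα _) (rho_ne_zero hα _))))

theorem orbit_level (s : ℤ) :
    (∀ k, level s < k → orbit hα s k = 0) ∧ orbit hα s (level s) ≠ 0 := by
  by_cases hs : 0 < s
  · obtain ⟨m, rfl⟩ : ∃ m : ℕ, s = m + 1 := ⟨(s - 1).toNat, by lia⟩
    have : level (m + 1) = 2 * m + 1 := by rw [level, if_pos hs]; lia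
    rw [this]
    exact orbit_pos hα m
  · obtain ⟨m, rfl⟩ : ∃ m : ℕ, s = -m := ⟨(-s).toNat, by lia⟩
    have : level (-m) = 2 * m := by rw [level, if_neg hs]; lia
    rw [this]
    exact orbit_neg hα m

theorem linearIndependent_orbit : LinearIndependent ℂ (orbit hα) := by
  rw [linearIndependent_iff]
  intro c hc
  by_contra hne
  obtain ⟨s, hs, hmax⟩ := Finset.exists_max_image c.support level
    (Finsupp.support_nonempty_iff.2 hne)
  have h := DFunLike.congr_fun hc (level s)
  rw [Finsupp.linearCombination_apply, Finsupp.sum, Finsupp.finsetSum_apply,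
    Finset.sum_eq_single s] at h
  · exact mul_ne_zero (Finsupp.mem_support_iff.1 hs) (orbit_level hα s).2 h
  · intro t ht hts
    have hlt : level t < level s := (hmax t ht).lt_of_ne fun he => hts (level_injective he)
    simp [(orbit_level hα t).1 _ hlt]
  · exact fun h => absurd hs h

theorem mem_of_single_mem {W : Submodule ℂ (ℕ →₀ ℂ)} {w : ℕ →₀ ℂ}
    (h : ∀ k, w k ≠ 0 → Finsupp.single k 1 ∈ W) : w ∈ W := by
  rw [← Finsupp.sum_single w]
  refine W.sum_mem fun k hk => ?_
  rw [← mul_one (w k), ← smul_eq_mul, ← Finsupp.smul_single]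
  exact W.smul_mem _ (h k (Finsupp.mem_support_iff.1 hk))

/-- Triangular inversion: the orbit vector of level $j$ has a nonzero last coordinate at $j$, and
the rest of it is covered by induction. Keeping track of levels, beyond mere spanning, is what later
turns band conditions into vanishing coefficients. -/
theorem single_mem_span_orbit (j : ℕ) :
    Finsupp.single j (1 : ℂ) ∈ Submodule.span ℂ (orbit hα '' {s | level s ≤ j}) := by
  induction j using Nat.strong_induction_on with
  | _ j ih =>
    set W := Submodule.span ℂ (orbit hα '' {s | level s ≤ j})
    obtain ⟨s, rfl⟩ := level_surjective j
    have hs : orbit hα s ∈ W := Submodule.subset_span ⟨s, le_refl (level s), rfl⟩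
    obtain ⟨h1, h2⟩ := orbit_level hα s
    have h3 : (orbit hα s).erase (level s) ∈ W := by
      refine mem_of_single_mem fun k hk => ?_
      have hne : k ≠ level s := fun h => hk (by rw [h, Finsupp.erase_same])
      rw [Finsupp.erase_ne hne] at hk
      have hlt : k < level s := (not_lt.1 fun h => hk (h1 k h)).lt_of_ne hne
      exact Submodule.span_mono (Set.image_mono fun t (ht : level t ≤ k) => ht.trans hlt.le)
        (ih k hlt)
    have h4 : Finsupp.single (level s) (orbit hα s (level s)) ∈ W := by
      rw [← Finsupp.single_add_erase (level s) (orbit hα s)] at hs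
      exact (W.add_mem_iff_left h3).1 hs
    have h5 := W.smul_mem (orbit hα s (level s))⁻¹ h4
    rwa [Finsupp.smul_single, smul_eq_mul, inv_mul_cancel₀ h2] at h5

theorem mem_span_orbit {w : ℕ →₀ ℂ} {j : ℕ} (hw : ∀ k, j < k → w k = 0) :
    w ∈ Submodule.span ℂ (orbit hα '' {s | level s ≤ j}) :=
  mem_of_single_mem fun k hk =>
    Submodule.span_mono (Set.image_mono fun t (ht : level t ≤ k) =>
      ht.trans (not_lt.1 fun h => hk (hw k h))) (single_mem_span_orbit hα k)

/-- The basis `C ^ s e₀` of the space of finitely supported vectors. -/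
noncomputable def orbitBasis : Module.Basis ℤ ℂ (ℕ →₀ ℂ) :=
  Module.Basis.mk (linearIndependent_orbit hα) fun _ _ => mem_of_single_mem fun k _ =>
    Submodule.span_mono (Set.image_subset_range _ _) (single_mem_span_orbit hα k)

@[simp] theorem orbitBasis_apply (s : ℤ) : orbitBasis hα s = orbit hα s := by
  simp [orbitBasis]

theorem repr_eq_zero_of_level {w : ℕ →₀ ℂ} {j : ℕ} (hw : ∀ k, j < k → w k = 0) {t : ℤ}
    (ht : j < level t) : (orbitBasis hα).repr w t = 0 := by
  have h := mem_span_orbit hα hw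
  rw [show orbit hα = orbitBasis hα by ext1 s; simp, Module.Basis.mem_span_image] at h
  by_contra hc
  exact absurd (h (Finsupp.mem_support_iff.2 hc)) (not_le.2 ht)

/-! ### Diagonals in the orbit basis -/

theorem repr_unitC (w : ℕ →₀ ℂ) (t : ℤ) :
    (orbitBasis hα).repr ((unitC hα : Module.End ℂ (ℕ →₀ ℂ)) w) (t + 1)
      = (orbitBasis hα).repr w t := by
  have h : ((orbitBasis hα).coord (t + 1)).comp (unitC hα : Module.End ℂ (ℕ →₀ ℂ))
      = (orbitBasis hα).coord t := by
    refine (orbitBasis hα).ext fun s => ?_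
    rw [LinearMap.comp_apply, orbitBasis_apply, unitC_orbit, ← orbitBasis_apply,
      ← orbitBasis_apply]
    simp only [Module.Basis.coord_apply, Module.Basis.repr_self, Finsupp.single_apply,
      add_left_inj]
  exact DFunLike.congr_fun h w

/-- A sequence on $\mathbb Z$ whose $n$-th difference vanishes is polynomial, so vanishing near one
end forces it to be zero. The filter `F` stands for either end of $\mathbb Z$; shift invariance lets
the induction pass to differences. -/
theorem repr_diagonal_eq_zero {F : Filter ℤ} [F.NeBot]
    (hF : Filter.Tendsto (fun s : ℤ => s + 1) F F) (n : ℕ) (l : ℤ)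
    (X : Module.End ℂ (ℕ →₀ ℂ))
    (hX : (comm (unitC hα : Module.End ℂ (ℕ →₀ ℂ)))^[n] X = 0)
    (hl : ∀ᶠ s in F, (orbitBasis hα).repr (X (orbit hα s)) (l + s) = 0) (s : ℤ) :
    (orbitBasis hα).repr (X (orbit hα s)) (l + s) = 0 := by
  induction n generalizing l X s with
  | zero =>
    have : X = 0 := hX
    simp [this]
  | succ n ih =>
    set f : ℤ → ℂ := fun s => (orbitBasis hα).repr (X (orbit hα s)) (l + s) with hf
    have key (s : ℤ) : (orbitBasis hα).repr
        (comm (unitC hα : Module.End ℂ (ℕ →₀ ℂ)) X (orbit hα s)) (l + 1 + s)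
          = f s - f (s + 1) := by
      rw [comm, LinearMap.sub_apply, Module.End.mul_apply, Module.End.mul_apply, unitC_orbit,
        map_sub, Finsupp.sub_apply, show l + 1 + s = l + s + 1 by ring, repr_unitC, hf]
      simp only [add_assoc]
    -- Diagonal $l+1$ of the commutator is the difference of diagonal $l$ of `X`, and it inherits
    -- eventual vanishing.
    have hconst (s : ℤ) : f (s + 1) = f s := by
      have h := ih (l + 1) _ hX (by
        filter_upwards [hl, hF.eventually hl] with s h1 h2
        rw [key]
        simp only [hf, h1, h2, sub_zero]) s
      rw [key] at h
      exact (sub_eq_zero.1 h).symm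
    have hall (s : ℤ) : f s = f 0 := by
      induction s with
      | zero => rfl
      | succ i ih => rw [hconst, ih]
      | pred i ih => rw [← ih, ← hconst (-i - 1), sub_add_cancel]
    obtain ⟨r, hr⟩ := hl.exists
    exact (hall s).trans ((hall r).symm.trans hr)

theorem toEnd_orbit_eq_smul {n : ℕ} {A : InfMatrix} (hA : ColFinite A) {J : ℕ}
    (hJ : ∀ i j, J ≤ i ∨ J ≤ j → i + 1 < j ∨ j + 1 < i → A i j = 0)
    (had : (comm (unitC hα : Module.End ℂ (ℕ →₀ ℂ)))^[n] (toEnd A) = 0) (s : ℤ) :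
    ∃ c : ℂ, toEnd A (orbit hα s) = c • orbit hα s := by
  have hband (s : ℤ) (hs : J ≤ level s) (k : ℕ) (hk : level s + 1 < k) :
      toEnd A (orbit hα s) k = 0 :=
    toEnd_apply_eq_zero hA (orbit_level hα s).1 fun i hi => hJ k i (by lia) (by lia)
  have hzero (l : ℤ) (hl : l ≠ 0) : (orbitBasis hα).repr (toEnd A (orbit hα s)) (l + s) = 0 := by
    rcases hl.lt_or_gt with hl | hl
    · refine repr_diagonal_eq_zero hα (F := Filter.atBot)
        (Filter.tendsto_atBot_add_const_right _ _ Filter.tendsto_id) n l _ had ?_ s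
      -- For $s\le0$ a shift by $l<0$ raises the level by $-2l\ge2$, beyond the single step that a
      -- tridiagonal column allows. The case $l>0$ mirrors this at $+\infty$, where $J+1$ ensures
      -- $s>0$.
      filter_upwards [Filter.eventually_le_atBot (-J : ℤ)] with s hs
      have h1 : (level s : ℤ) = -2 * s := by unfold level; split_ifs <;> lia
      have h2 : (level (l + s) : ℤ) = -2 * (l + s) := by unfold level; split_ifs <;> lia
      exact repr_eq_zero_of_level hα (hband s (by lia)) (by lia)
    · refine repr_diagonal_eq_zero hα (F := Filter.atTop)
        (Filter.tendsto_atTop_add_const_right _ _ Filter.tendsto_id) n l _ had ?_ s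
      filter_upwards [Filter.eventually_ge_atTop (J + 1 : ℤ)] with s hs
      have h1 : (level s : ℤ) = 2 * s - 1 := by unfold level; split_ifs <;> lia
      have h2 : (level (l + s) : ℤ) = 2 * (l + s) - 1 := by unfold level; split_ifs <;> lia
      exact repr_eq_zero_of_level hα (hband s (by lia)) (by lia)
  refine ⟨(orbitBasis hα).repr (toEnd A (orbit hα s)) s, (orbitBasis hα).repr.injective ?_⟩
  ext t
  rw [map_smul, ← orbitBasis_apply hα s, Module.Basis.repr_self]
  by_cases hts : t = s
  · simp [hts]
  · have h := hzero (t - s) (sub_ne_zero.2 hts)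
    rw [sub_add_cancel] at h
    simp [h, hts]

/-! ### From diagonal in the orbit basis to scalar -/

/-- An operator diagonal on the orbit preserves every span of orbit vectors of level at most $j$,
and $e_j$ lies in such a span. -/
theorem upperTriangular_of_orbit {A : InfMatrix} (hA : ColFinite A)
    (h : ∀ s, ∃ c : ℂ, toEnd A (orbit hα s) = c • orbit hα s) {i j : ℕ} (hij : j < i) :
    A i j = 0 := by
  rw [← toEnd_single hA]
  have hj := single_mem_span_orbit hα j
  generalize Finsupp.single j (1 : ℂ) = e at hj
  induction hj using Submodule.span_induction with
  | mem w hw =>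
    obtain ⟨s, hs, rfl⟩ := hw
    obtain ⟨c, hc⟩ := h s
    rw [hc, Finsupp.smul_apply, (orbit_level hα s).1 i (lt_of_le_of_lt hs hij), smul_zero]
  | zero => simp
  | add x y _ _ hx hy => rw [map_add, Finsupp.add_apply, hx, hy, add_zero]
  | smul a x _ hx => rw [map_smul, Finsupp.smul_apply, hx, smul_zero]

theorem eq_smul_one_of_diagonal {α : ℕ → ℂ} (hα : ∀ k, ‖α k‖ < 1) (hα0 : ∃ k, α k ≠ 0) {A : InfMatrix}
    (hdiag : ∀ i j, i ≠ j → A i j = 0) {c : ℂ}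
    (hc : ∀ i j, matC α i j * (A i i - A j j) = c * matC α i j) :
    ∃ c : ℂ, A = c • (1 : InfMatrix) := by
  have step {i j : ℕ} (h : matC α i j ≠ 0) : A i i - A j j = c :=
    mul_left_cancel₀ h ((hc i j).trans (mul_comm _ _))
  have hρ := rho_ne_zero hα
  have heven (m : ℕ) : A (2 * m) (2 * m) = A 0 0 - m * c := by
    induction m with
    | zero => simp
    | succ m ih =>
      have h := step ((matC_even_add_two α m).trans_ne (mul_ne_zero (hρ _) (hρ _)))
      rw [mul_add_one]
      push_cast
      linear_combination ih - h
  have hodd (m : ℕ) : A (2 * m + 1) (2 * m + 1) = A 0 0 + (m + 1) * c := by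
    induction m with
    | zero =>
      have h := step ((matC_one_zero α).trans_ne (hρ _))
      simp only [mul_zero, zero_add, Nat.cast_zero]
      linear_combination h
    | succ m ih =>
      have h := step ((matC_odd_add_two α m).trans_ne (mul_ne_zero (hρ _) (hρ _)))
      rw [show 2 * (m + 1) + 1 = 2 * m + 3 by ring]
      push_cast
      linear_combination ih + h
  -- A nonzero $\alpha_k$ makes one more entry of $\mathcal C$ nonzero, on or next to the diagonal;
  -- its relation clashes with the two progressions and leaves $(k+1)c=0$.
  have hc0 : c = 0 := by
    obtain ⟨k, hk⟩ := hα0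
    have hk' : conj (α k) ≠ 0 := (map_ne_zero _).2 hk
    obtain rfl | ⟨m, rfl | rfl⟩ : k = 0 ∨ ∃ m, k = 2 * m + 1 ∨ k = 2 * m + 2 := by
      rcases Nat.even_or_odd' k with ⟨m, rfl | rfl⟩
      · rcases m with _ | m
        · exact .inl rfl
        · exact .inr ⟨m, .inr (by ring)⟩
      · exact .inr ⟨m, .inl rfl⟩
    · simpa using (step ((matC_zero_zero α).trans_ne hk')).symm
    · have h := step ((matC_even_add_one α m).trans_ne (mul_ne_zero (hρ _) hk'))
      have h2 : ((2 * m + 2 : ℕ) : ℂ) * c = 0 := by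
        push_cast
        linear_combination heven m - hodd m - h
      exact (mul_eq_zero.1 h2).resolve_left (Nat.cast_ne_zero.2 (by lia))
    · have h := step ((matC_add_one_odd α m).trans_ne (mul_ne_zero hk' (hρ _)))
      have h1 := heven (m + 1)
      rw [mul_add_one] at h1
      have h2 : ((2 * m + 3 : ℕ) : ℂ) * c = 0 := by
        push_cast at h1 ⊢
        linear_combination h1 - hodd m - h
      exact (mul_eq_zero.1 h2).resolve_left (Nat.cast_ne_zero.2 (by lia))
  refine ⟨A 0 0, ?_⟩
  ext i j
  by_cases hij : i = j
  · subst hij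
    rcases Nat.even_or_odd' i with ⟨m, rfl | rfl⟩
    · simp [heven m, hc0]
    · simp [hodd m, hc0]
  · simp [hdiag i j hij, Matrix.one_apply_ne hij]

theorem conj_sub_orbit {X : Module.End ℂ (ℕ →₀ ℂ)}
    (h : ∀ s, ∃ c : ℂ, X (orbit hα s) = c • orbit hα s) (s : ℤ) :
    ∃ c : ℂ, (↑(unitC hα)⁻¹ * (X * unitC hα) - X : Module.End ℂ (ℕ →₀ ℂ)) (orbit hα s)
      = c • orbit hα s := by
  obtain ⟨a, ha⟩ := h (s + 1)
  obtain ⟨b, hb⟩ := h s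
  refine ⟨a - b, ?_⟩
  rw [LinearMap.sub_apply, Module.End.mul_apply, Module.End.mul_apply, unitC_orbit, ha, hb,
    map_smul, unitC_inv_orbit, sub_smul]

/-- The induction assumes diagonality on the orbit for `A` and `Aᴴ` in place of a band condition:
`conj_sub_orbit` shows that $A\mapsto\mathcal C^\dagger A\,\mathcal C-A$ preserves it, while that
map lowers the order of the vanishing commutator by one. -/
theorem eq_smul_one_of_orbit (hα0 : ∃ k, α k ≠ 0) (n : ℕ) (A : InfMatrix)
    (hA : ColFinite A) (hA' : ColFinite Aᴴ)
    (h : ∀ s, ∃ c : ℂ, toEnd A (orbit hα s) = c • orbit hα s)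
    (h' : ∀ s, ∃ c : ℂ, toEnd Aᴴ (orbit hα s) = c • orbit hα s)
    (had : (comm (unitC hα : Module.End ℂ (ℕ →₀ ℂ)))^[n] (toEnd A) = 0) :
    ∃ c : ℂ, A = c • (1 : InfMatrix) := by
  induction n generalizing A with
  | zero =>
    refine ⟨0, ?_⟩
    rw [zero_smul]
    exact toEnd_injective hA colFinite_zero (had.trans toEnd_zero.symm)
  | succ n ih =>
    have hC := colFinite_matC α
    have hC' := colFinite_matC_conjTranspose α
    have hE : toEnd (mul (matC α)ᴴ (mul A (matC α)) - A)
        = ↑(unitC hα)⁻¹ * (toEnd A * unitC hα) - toEnd A := by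
      rw [toEnd_sub (hC'.mul (hA.mul hC)) hA, toEnd_mul hC' (hA.mul hC), toEnd_mul hA hC,
        inv_unitC, val_unitC]
    have hT : (mul (matC α)ᴴ (mul A (matC α)) - A)ᴴ
        = mul (mul (matC α)ᴴ Aᴴ) (matC α) - Aᴴ := by
      rw [Matrix.conjTranspose_sub, conjTranspose_mul, conjTranspose_mul,
        Matrix.conjTranspose_conjTranspose]
    have hE' : toEnd (mul (matC α)ᴴ (mul A (matC α)) - A)ᴴ
        = ↑(unitC hα)⁻¹ * (toEnd Aᴴ * unitC hα) - toEnd Aᴴ := by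
      rw [hT, toEnd_sub ((hC'.mul hA').mul hC) hA', toEnd_mul (hC'.mul hA') hC,
        toEnd_mul hC' hA', inv_unitC, val_unitC, mul_assoc]
    obtain ⟨c, hc⟩ := ih (mul (matC α)ᴴ (mul A (matC α)) - A)
      ((hC'.mul (hA.mul hC)).sub hA) (by rw [hT]; exact ((hC'.mul hA').mul hC).sub hA')
      (by rw [hE]; exact conj_sub_orbit hα h) (by rw [hE']; exact conj_sub_orbit hα h')
      (by rw [hE]; exact comm_iterate_conj_sub _ n _ had)
    -- Both `A` and `Aᴴ` are upper triangular.
    have hdiag (i j : ℕ) (hij : i ≠ j) : A i j = 0 := by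
      rcases hij.lt_or_gt with hlt | hgt
      · have := upperTriangular_of_orbit hα hA' h' hlt
        rwa [Matrix.conjTranspose_apply, star_eq_zero] at this
      · exact upperTriangular_of_orbit hα hA h hgt
    refine eq_smul_one_of_diagonal hα hα0 hdiag (c := c) fun i j => ?_
    have h1 : toEnd (c • (1 : InfMatrix)) = c • 1 := by
      have hcf : ColFinite (c • (1 : InfMatrix)) := fun j =>
        (colFinite_one j).subset (Function.support_const_smul_subset c _)
      refine end_ext fun i j => ?_
      rw [toEnd_single hcf, LinearMap.smul_apply, Finsupp.smul_apply, ← toEnd_one,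
        toEnd_single colFinite_one, Matrix.smul_apply]
    -- The scalar relation multiplied by $\mathcal C$ reads $A\,\mathcal C-\mathcal C A=c\,\mathcal
    -- C$; with `A` diagonal, its entries are the hypothesis of `eq_smul_one_of_diagonal`.
    have h2 : toEnd A (toEnd (matC α) (Finsupp.single j 1))
        - toEnd (matC α) (toEnd A (Finsupp.single j 1))
          = c • toEnd (matC α) (Finsupp.single j 1) := by
      have h2 := DFunLike.congr_fun ((hE.symm.trans (congrArg toEnd hc)).trans h1)
        (Finsupp.single j 1)
      rw [LinearMap.sub_apply, Module.End.mul_apply, Module.End.mul_apply,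
        LinearMap.smul_apply, Module.End.one_apply] at h2
      rw [← val_unitC hα, ← map_smul, ← h2, map_sub, ← Module.End.mul_apply _ (unitC hα)⁻¹.val,
        Units.mul_inv, Module.End.one_apply]
    have h3 := DFunLike.congr_fun h2 i
    have h4 (w : ℕ →₀ ℂ) (i : ℕ) : toEnd A w i = w i * A i i := by
      rw [toEnd_apply hA]
      refine Finset.sum_eq_single i (fun k _ hk => ?_) fun hi => ?_
      · rw [hdiag i k hk.symm, mul_zero]
      · rw [Finsupp.notMem_support_iff.1 hi, zero_mul]
    have h5 : toEnd A (Finsupp.single j 1) = A j j • Finsupp.single j 1 := by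
      ext k
      rw [toEnd_single hA]
      by_cases hkj : k = j
      · simp [hkj]
      · simp [hdiag k j hkj, hkj]
    rw [Finsupp.sub_apply, h5, map_smul, h4, Finsupp.smul_apply, Finsupp.smul_apply,
      toEnd_single hC, smul_eq_mul, smul_eq_mul] at h3
    linear_combination h3

/-! ### Reduction to the iterated commutator, for $\Omega$ and its adjoint -/

theorem IsAlmostTridiagonal.exists_bound {A : InfMatrix} (hA : IsAlmostTridiagonal A) :
    ∃ J, ∀ i j, J ≤ i ∨ J ≤ j → i + 1 < j ∨ j + 1 < i → A i j = 0 := by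
  obtain ⟨T, hT, hfin⟩ := hA
  obtain ⟨⟨a, b⟩, hab⟩ := hfin.bddAbove
  refine ⟨a + b + 1, fun i j hij h => ?_⟩
  by_contra hne
  have hmem : (i, j) ∈ {p : ℕ × ℕ | (A - T) p.1 p.2 ≠ 0} := by
    simpa [hT i j h] using hne
  have := hab hmem
  rw [Prod.mk_le_mk] at this
  lia

theorem colFinite_of_bound {A : InfMatrix} {J : ℕ}
    (hJ : ∀ i j, J ≤ i ∨ J ≤ j → i + 1 < j ∨ j + 1 < i → A i j = 0) : ColFinite A := fun j =>
  (Set.finite_Iic (J + j + 1)).subset fun i hi => by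
    by_contra h
    rw [Set.mem_Iic] at h
    exact hi (hJ i j (by lia) (by lia))

theorem conjTranspose_ad (A B : InfMatrix) : (ad A B)ᴴ = -ad Aᴴ Bᴴ := by
  rw [ad, ad, Matrix.conjTranspose_sub, conjTranspose_mul, conjTranspose_mul, neg_sub]

theorem ad_neg (A B : InfMatrix) : ad A (-B) = -ad A B := by
  ext i j
  change ∑ᶠ k, A i k * -B k j - ∑ᶠ k, -B i k * A k j
    = -(∑ᶠ k, A i k * B k j - ∑ᶠ k, B i k * A k j)
  simp only [mul_neg, neg_mul, finsum_neg_distrib]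
  ring

theorem comm_iterate_eq_zero_of_hermAd {n : ℕ} {A : InfMatrix} (hA : ColFinite A)
    (h : hermAd α n A = 0) :
    (comm (unitC hα : Module.End ℂ (ℕ →₀ ℂ)))^[n] (toEnd A) = 0 := by
  have hC := colFinite_matC α
  have hC' := colFinite_matC_conjTranspose α
  have hP := colFinite_pow hC' (n / 2)
  have hY := hC.ad_iterate hA n
  have hX := (hP.mul hY).mul hP
  have key : toEnd (mul (mul (pow (matC α)ᴴ (n / 2)) ((ad (matC α))^[n] A))
      (pow (matC α)ᴴ (n / 2))) = 0 := by
    unfold hermAd at h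
    by_cases hn : Even n
    · rw [if_pos hn] at h
      rw [h, toEnd_zero]
    · rw [if_neg hn] at h
      have hL := colFinite_matL_conjTranspose α
      have h1 := congrArg toEnd h
      rw [toEnd_zero, toEnd_mul (hL.mul hX) (colFinite_matM_conjTranspose α),
        toEnd_mul hL hX] at h1
      exact (unitL hα)⁻¹.mul_right_eq_zero.1 ((unitM hα)⁻¹.mul_left_eq_zero.1 h1)
  rw [toEnd_mul (hP.mul hY) hP, toEnd_mul hP hY, toEnd_pow hC', toEnd_ad_iterate hC hA,
    ← inv_unitC hα, ← val_unitC hα, ← Units.val_pow_eq_pow_val] at key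
  exact (Units.mul_right_eq_zero _).1 ((Units.mul_left_eq_zero _).1 key)

theorem comm_iterate_conjTranspose {n : ℕ} {A : InfMatrix} (hA : ColFinite A)
    (hA' : ColFinite Aᴴ)
    (h : (comm (unitC hα : Module.End ℂ (ℕ →₀ ℂ)))^[n] (toEnd A) = 0) :
    (comm (unitC hα : Module.End ℂ (ℕ →₀ ℂ)))^[n] (toEnd Aᴴ) = 0 := by
  have hC := colFinite_matC α
  have hC' := colFinite_matC_conjTranspose α
  refine comm_iterate_eq_zero_of_inv _ n _ ?_
  rw [val_unitC, ← toEnd_ad_iterate hC hA] at h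
  have h0 : (ad (matC α))^[n] A = 0 :=
    toEnd_injective (hC.ad_iterate hA n) colFinite_zero (h.trans toEnd_zero.symm)
  -- Each adjoint of a commutator costs a sign; only vanishing matters, so the sign is left
  -- undetermined.
  have hsign (k : ℕ) : ((ad (matC α))^[k] A)ᴴ = (ad (matC α)ᴴ)^[k] Aᴴ ∨
      ((ad (matC α))^[k] A)ᴴ = -(ad (matC α)ᴴ)^[k] Aᴴ := by
    induction k with
    | zero => exact .inl rfl
    | succ k ih =>
      rw [Function.iterate_succ_apply', conjTranspose_ad, Function.iterate_succ_apply']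
      rcases ih with h | h <;> rw [h]
      · exact .inr rfl
      · rw [ad_neg, neg_neg]
        exact .inl rfl
  have h1 : (ad (matC α)ᴴ)^[n] Aᴴ = 0 := by
    rcases hsign n with h | h <;> rw [h0, Matrix.conjTranspose_zero] at h
    · exact h.symm
    · exact neg_eq_zero.1 h.symm
  rw [inv_unitC, ← toEnd_ad_iterate hC' hA', h1, toEnd_zero]

end CMV

theorem mainTheorem1 (α : ℕ → ℂ) (hα : ∀ k, ‖α k‖ < 1) (hα0 : ∃ k, α k ≠ 0)
    (n : ℕ) (Ω : CMV.InfMatrix) (hΩ : CMV.IsAlmostTridiagonal Ω)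
    (had : CMV.hermAd α n Ω = 0) :
    ∃ c : ℂ, Ω = c • (1 : CMV.InfMatrix) := by
  obtain ⟨J, hJ⟩ := hΩ.exists_bound
  have hJ' : ∀ i j, J ≤ i ∨ J ≤ j → i + 1 < j ∨ j + 1 < i → Ωᴴ i j = 0 := fun i j h1 h2 => by
    rw [Matrix.conjTranspose_apply, hJ j i h1.symm h2.symm, star_zero]
  have hcf := CMV.colFinite_of_bound hJ
  have hcf' := CMV.colFinite_of_bound hJ'
  have h := CMV.comm_iterate_eq_zero_of_hermAd hα hcf had
  exact CMV.eq_smul_one_of_orbit hα hα0 n Ω hcf hcf' (CMV.toEnd_orbit_eq_smul hα hcf hJ h)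
    (CMV.toEnd_orbit_eq_smul hα hcf' hJ' (CMV.comm_iterate_conjTranspose hα hcf hcf' h)) h
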